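/- **Corollary (existence of a solution to the gradient scheme).** *Data.* Let $d\ge 1$, let $\Omega\subset\mathbb R^d$ be open and bounded, let $T>0$, $p\in(1,+\infty)$ and $p'=\frac{p}{p-1}$. Let $\zeta,\beta:\mathbb R\to\mathbb R$ be non-decreasing and Lipschitz continuous with $\zeta(0)=\beta(0)=0$, and suppose that there are $M_0,M_1>0$ with $|\zeta(s)|\ge M_0|s|-M_1$ for all $s\in\mathbb R$. Set $\nu(s)=\int_0^s\zeta'(q)\beta'(q)\,dq$. Let $a:\Omega\times\mathbb R\times\mathbb R^d\to\mathbb R^d$ be a Carathéodory function (for a.e. $x\in\Omega$, $(s,\xi)\mapsto a(x,s,\xi)$ is continuous; for all $(s,\xi)$, $x\mapsto a(x,s,\xi)$ is measurable) such that there exist $\underline a>0$, $\mu>0$ and $\overline a\in L^{p'}(\Omega)$ with, for a.e. $x\in\Omega$, all $s\in\mathbb R$ and all $\xi,\chi\in\mathbb R^d$, $$a(x,s,\xi)\cdot\xi\ge\underline a|\xi|^p,\qquad (a(x,s,\xi)-a(x,s,\chi))\cdot(\xi-\chi)\ge 0,\qquad |a(x,s,\xi)|\le\overline a(x)+\mu|\xi|^{p-1}.$$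 Let $u_{\rm ini}\in L^2(\Omega)$ and $f\in L^{p'}(\Omega\times(0,T))$. *Space-time gradient discretisation.* Let $\mathcal D=(X_{\mathcal D,0},\Pi_{\mathcal D},\nabla_{\mathcal D},\mathcal I_{\mathcal D},(t^{(n)})_{n=0,\dots,N})$ be such that: - $X_{\mathcal D,0}=\mathbb R^I$ for a finite set $I$; - $\Pi_{\mathcal D}:X_{\mathcal D,0}\to L^\infty(\Omega)$ is linear, and there are pairwise disjoint sets $(\Omega_i)_{i\in I}$ with $\Omega=\bigcup_{i\in I}\Omega_i$ such that $\Pi_{\mathcal D}u=u_i$ a.e. on $\Omega_i$ for all $u=(u_i)_{i\in I}\in X_{\mathcal D,0}$ and $i\in I$; - $\nabla_{\mathcal D}:X_{\mathcal D,0}\to L^p(\Omega)^d$ is linear and $\|\nabla_{\mathcal D}\cdot\|_{L^p(\Omega)^d}$ is a norm on $X_{\mathcal D,0}$; - $\mathcal I_{\mathcal D}:L^2(\Omega)\to X_{\mathcal D,0}$ is linear; - $0=t^{(0)}<t^{(1)}<\dots<t^{(N)}=T$. For $\chi:\mathbb R\to\mathbb R$ and $u\in X_{\mathcal D,0}$ write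 $\chi(u)=(\chi(u_i))_{i\in I}$. For a family $v=(v^{(n)})$ in $X_{\mathcal D,0}$, $n\in\{0,\dots,N-1\}$ and $t\in(t^{(n)},t^{(n+1)}]$, write $\Pi_{\mathcal D}v(x,t)=\Pi_{\mathcal D}v^{(n+1)}(x)$, $\nabla_{\mathcal D}v(x,t)=\nabla_{\mathcal D}v^{(n+1)}(x)$ and $\delta_{\mathcal D}v(t)=\dfrac{v^{(n+1)}-v^{(n)}}{t^{(n+1)}-t^{(n)}}\in X_{\mathcal D,0}$. *Conclusion.* There exists a family $u=(u^{(n)})_{n=0,\dots,N}\subset X_{\mathcal D,0}$ such that $u^{(0)}=\mathcal I_{\mathcal D}u_{\rm ini}$ and, for all $v=(v^{(n)})_{n=1,\dots,N}\subset X_{\mathcal D,0}$, $$\int_0^T\!\!\int_\Omega\Big[\Pi_{\mathcal D}\delta_{\mathcal D}\beta(u)(x,t)\,\Pi_{\mathcal D}v(x,t)+a\big(x,\Pi_{\mathcal D}\nu(u)(x,t),\nabla_{\mathcal D}\zeta(u)(x,t)\big)\cdot\nabla_{\mathcal D}v(x,t)\Big]dx\,dt=\int_0^T\!\!\int_\Omega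 f(x,t)\,\Pi_{\mathcal D}v(x,t)\,dx\,dt.$$ -/

import Mathlib

open MeasureTheory Set
open scoped ENNReal NNReal

noncomputable section

/-- The Euclidean space `ℝ^d`. -/
abbrev Rd (d : ℕ) : Type := EuclideanSpace ℝ (Fin d)

/-- The data hypotheses: domain, final time, nonlinearities `ζ` and `β`, Leray--Lions operator `a`
with exponent `p`, and source term `f`. (The initial datum is given directly as an element
of `L²(Ω)`.) "Measurable" is Lebesgue measurable, i.e. a.e. equal to a Borel function. -/
structure DataHypotheses (d : ℕ) (Ω : Set (Rd d)) (T p : ℝ) (ζ β : ℝ → ℝ)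
    (a : Rd d → ℝ → Rd d → Rd d) (f : Rd d → ℝ → ℝ) : Prop where
  dim_pos : 1 ≤ d
  isOpen : IsOpen Ω
  isBounded : Bornology.IsBounded Ω
  T_pos : 0 < T
  one_lt_p : 1 < p
  zeta_mono : Monotone ζ
  zeta_lipschitz : ∃ L : ℝ≥0, 0 < L ∧ LipschitzWith L ζ
  zeta_zero : ζ 0 = 0
  zeta_coercive : ∃ M₀ M₁ : ℝ, 0 < M₀ ∧ 0 < M₁ ∧ ∀ s : ℝ, M₀ * |s| - M₁ ≤ |ζ s|
  beta_mono : Monotone β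
  beta_lipschitz : ∃ L : ℝ≥0, 0 < L ∧ LipschitzWith L β
  beta_zero : β 0 = 0
  a_continuous : ∀ᵐ x ∂(volume.restrict Ω), Continuous fun q : ℝ × Rd d => a x q.1 q.2
  a_measurable : ∀ (s : ℝ) (ξ : Rd d), AEMeasurable (fun x => a x s ξ) (volume.restrict Ω)
  a_coercive : ∃ c : ℝ, 0 < c ∧ ∀ᵐ x ∂(volume.restrict Ω), ∀ (s : ℝ) (ξ : Rd d),
    c * ‖ξ‖ ^ p ≤ inner ℝ (a x s ξ) ξ
  a_monotone : ∀ᵐ x ∂(volume.restrict Ω), ∀ (s : ℝ) (ξ χ : Rd d),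
    0 ≤ inner ℝ (a x s ξ - a x s χ) (ξ - χ)
  a_growth : ∃ (A : Rd d → ℝ) (μ : ℝ),
    MemLp A (ENNReal.ofReal (p / (p - 1))) (volume.restrict Ω) ∧ 0 < μ ∧
    ∀ᵐ x ∂(volume.restrict Ω), ∀ (s : ℝ) (ξ : Rd d), ‖a x s ξ‖ ≤ A x + μ * ‖ξ‖ ^ (p - 1)
  f_memLp : MemLp (fun z : Rd d × ℝ => f z.1 z.2) (ENNReal.ofReal (p / (p - 1)))
    (volume.restrict (Ω ×ˢ Ioo 0 T))

/-- `ν(s) = ∫₀ˢ ζ'(q) β'(q) dq`. -/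
def nuFun (ζ β : ℝ → ℝ) (s : ℝ) : ℝ := ∫ q in (0 : ℝ)..s, deriv ζ q * deriv β q

/-- Space-time gradient discretisation for homogeneous Dirichlet boundary conditions, with finite
set `ι` of degrees of freedom; the space of discrete unknowns is `ι → ℝ`. -/
structure GradientDiscretisation {d : ℕ} (Ω : Set (Rd d)) (T p : ℝ) (ι : Type*) [Fintype ι] where
  /-- the subsets `Ω_i` of `Ω` attached to the degrees of freedom -/
  cell : ι → Set (Rd d)
  cell_disjoint : Pairwise fun i j => Disjoint (cell i) (cell j)
  iUnion_cell : ⋃ i, cell i = Ω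
  /-- the function reconstruction `Π_D` -/
  recon : (ι → ℝ) →ₗ[ℝ] Lp ℝ ∞ (volume.restrict Ω)
  recon_eq : ∀ (u : ι → ℝ) (i : ι), ∀ᵐ x ∂(volume.restrict Ω), x ∈ cell i → recon u x = u i
  /-- the gradient reconstruction `∇_D` -/
  grad : (ι → ℝ) →ₗ[ℝ] Lp (Rd d) (ENNReal.ofReal p) (volume.restrict Ω)
  /-- `‖∇_D ·‖` is a norm (the other norm axioms follow from linearity of `∇_D`) -/
  grad_norm : ∀ u : ι → ℝ, ‖grad u‖ = 0 → u = 0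
  /-- the interpolation operator `I_D` -/
  interp : Lp ℝ 2 (volume.restrict Ω) →ₗ[ℝ] (ι → ℝ)
  /-- the number of time steps -/
  N : ℕ
  /-- the times `t⁽⁰⁾ < ⋯ < t⁽ᴺ⁾` -/
  time : Fin (N + 1) → ℝ
  time_zero : time 0 = 0
  time_last : time (Fin.last N) = T
  time_strictMono : StrictMono time

namespace GradientDiscretisation

variable {d : ℕ} {Ω : Set (Rd d)} {T p : ℝ} {ι : Type*} [Fintype ι]

/-- The piecewise constant function of time with values in `X_{D,0}` equal to `w n` on
`(t⁽ⁿ⁾, t⁽ⁿ⁺¹⁾]`, for `n = 0, …, N-1`. -/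
def stepFun (D : GradientDiscretisation Ω T p ι) (w : Fin D.N → ι → ℝ) (t : ℝ) : ι → ℝ :=
  ∑ n : Fin D.N, (Ioc (D.time n.castSucc) (D.time n.succ)).indicator (fun _ => w n) t

/-- The discrete time derivative `δ_D^{(n+1/2)} v = (v⁽ⁿ⁺¹⁾ - v⁽ⁿ⁾) / (t⁽ⁿ⁺¹⁾ - t⁽ⁿ⁾)`. -/
def delta (D : GradientDiscretisation Ω T p ι) (v : Fin (D.N + 1) → ι → ℝ) (n : Fin D.N) : ι → ℝ :=
  (D.time n.succ - D.time n.castSucc)⁻¹ • (v n.succ - v n.castSucc)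

/-- `χ_I(u) = (χ(u_i))_{i ∈ I}`, applied to every element of a family of discrete unknowns. -/
def applyFun {κ : Type*} (χ : ℝ → ℝ) (u : κ → ι → ℝ) : κ → ι → ℝ := fun n i => χ (u n i)

/-- The family `u = (u⁽ⁿ⁾)_{n=0,…,N}` solves the implicit gradient scheme. In the test family
`v : Fin N → X_{D,0}`, the entry `v n` stands for `v⁽ⁿ⁺¹⁾`, the value on `(t⁽ⁿ⁾, t⁽ⁿ⁺¹⁾]`. -/
def IsSchemeSolution (D : GradientDiscretisation Ω T p ι) (ζ β : ℝ → ℝ)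
    (a : Rd d → ℝ → Rd d → Rd d) (f : Rd d → ℝ → ℝ) (uini : Lp ℝ 2 (volume.restrict Ω))
    (u : Fin (D.N + 1) → ι → ℝ) : Prop :=
  u 0 = D.interp uini ∧
  ∀ v : Fin D.N → ι → ℝ,
    ∫ t in (0 : ℝ)..T, ∫ x in Ω,
        (D.recon (D.stepFun (D.delta (applyFun β u)) t) x * D.recon (D.stepFun v t) x
          + inner ℝ
              (a x (D.recon (D.stepFun (fun n => applyFun (nuFun ζ β) u n.succ) t) x)
                (D.grad (D.stepFun (fun n => applyFun ζ u n.succ) t) x))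
              (D.grad (D.stepFun v t) x))
      = ∫ t in (0 : ℝ)..T, ∫ x in Ω, f x t * D.recon (D.stepFun v t) x

end GradientDiscretisation

end

/-! The scheme is implicit Euler in time, so it decouples: testing on one interval at a time, `u
n.succ` solves a finite-dimensional nonlinear system with `u n.castSucc` as data, and the family is
built by recursion. Each system reads `F w = 0` with `F` continuous (`continuous_stepForm`, by
dominated convergence). The a priori estimate comes from testing with `ζ(w)`: the mass term is
nonnegative because `β` and `ζ` have the same sign on each cell, the flux term dominates `‖ζ(w)‖ ^
p` (`exists_coercive_flux`), and the data are only linear in `ζ(w)`. Since `p > 1` and `ζ` is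
coercive, `F w` pairs positively with `ζ(w)` for large `w`. Monotonicity of `a` in the gradient
plays no role in finite dimension. Such an `F` has a zero by a Brouwer-type theorem
(`exists_eq_zero_of_inner_pos_on_sphere`), obtained from an analytic no-retraction argument: the
integral of `det (1 + t Dh)` over a ball is polynomial in `t` and equals the volume for small `t`,
hence also at `t = 1`, whereas a `C¹` retraction onto the sphere has zero Jacobian. -/

/-! ### Determinants of perturbations of the identity. -/

section Determinants

variable {E : Type*} [NormedAddCommGroup E] [NormedSpace ℝ E] [FiniteDimensional ℝ E]

/-- `det (1 + A)` is positive for `‖A‖ < 1`. -/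
theorem ContinuousLinearMap.det_one_add_pos_of_norm_lt_one (A : E →L[ℝ] E) (hA : ‖A‖ < 1) :
    0 < (1 + A).det := by
  have : CompleteSpace E := FiniteDimensional.complete ℝ E
  by_contra! hneg
  -- If the determinant were nonpositive at `t = 1`, it would vanish somewhere on the segment from
  -- `1` to `1 + A`, all of whose points are invertible by the Neumann series.
  have hcont : ContinuousOn (fun t : ℝ => (1 + t • A).det) (Icc 0 1) :=
    (ContinuousLinearMap.continuous_det.comp (by fun_prop)).continuousOn
  obtain ⟨t, ht, h0⟩ := intermediate_value_Icc' (zero_le_one' ℝ) hcont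
    (show (0 : ℝ) ∈ Icc _ _ by
      constructor
      · simpa using hneg
      · simp [ContinuousLinearMap.det])
  have hlt : ‖-(t • A)‖ < 1 := by
    rw [norm_neg, norm_smul, Real.norm_of_nonneg ht.1]
    nlinarith [norm_nonneg A, ht.2]
  have hu : IsUnit (1 + t • A) := by
    simpa using isUnit_one_sub_of_norm_lt_one hlt
  have hu' := hu.map (ContinuousLinearMap.toLinearMapRingHom (R₁ := ℝ) (M₁ := E))
  exact (LinearMap.isUnit_det _ hu').ne_zero h0

/-- `t ↦ det (1 + t A)` is a polynomial of degree at most `dim E`. -/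
theorem ContinuousLinearMap.exists_polynomial_det_one_add_smul (A : E →L[ℝ] E) :
    ∃ P : Polynomial ℝ, P.natDegree ≤ Module.finrank ℝ E ∧
      ∀ t : ℝ, P.eval t = (1 + t • A).det := by
  classical
  let b := Module.finBasis ℝ E
  let M := LinearMap.toMatrix b b A.toLinearMap
  refine ⟨Matrix.det ((Polynomial.X : Polynomial ℝ) • M.map Polynomial.C +
    (1 : Matrix _ _ ℝ).map Polynomial.C), ?_, fun t => ?_⟩
  · simpa using Polynomial.natDegree_det_X_add_C_le M 1
  · have h : (1 + t • A).toLinearMap = 1 + t • A.toLinearMap := rfl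
    rw [ContinuousLinearMap.det, h, ← LinearMap.det_toMatrix b, ← Polynomial.coe_evalRingHom,
      RingHom.map_det]
    congr 1
    ext i j
    simp [M, Matrix.one_apply, LinearMap.toMatrix_one, add_comm]
    split_ifs <;> simp [mul_comm]

/-- Evaluation at `1` of `t ↦ det (1 + t A)` through its values at finitely many nodes, with
weights of sum `1` that do not depend on `A`. -/
theorem ContinuousLinearMap.exists_weights_det_one_add {δ : ℝ} (hδ : 0 < δ) :
    ∃ (s : Finset ℕ) (t c : ℕ → ℝ), (∀ i ∈ s, 0 < t i ∧ t i ≤ δ) ∧ ∑ i ∈ s, c i = 1 ∧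
      ∀ A : E →L[ℝ] E, (1 + A).det = ∑ i ∈ s, c i * (1 + t i • A).det := by
  classical
  set n := Module.finrank ℝ E
  -- Lagrange interpolation at `n + 1` distinct nodes in `(0, δ]` is exact in degree at most `n`.
  -- The weights are the basis polynomials at `1`, and their sum is `1` because the basis sums to
  -- the constant polynomial `1`.
  let t : ℕ → ℝ := fun i => δ / (i + 1)
  have ht : Set.InjOn t (Finset.range (n + 1) : Finset ℕ) := by
    intro i _ j _ hij
    simp only [t] at hij
    have hi : (0 : ℝ) < i + 1 := by positivity
    have hj : (0 : ℝ) < j + 1 := by positivity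
    rw [div_eq_div_iff hi.ne' hj.ne'] at hij
    have := mul_left_cancel₀ hδ.ne' hij
    exact_mod_cast (by linarith : (i : ℝ) = j)
  refine ⟨Finset.range (n + 1), t,
    fun i => (Lagrange.basis (Finset.range (n + 1)) t i).eval 1, fun i _ => ⟨by positivity, ?_⟩,
    ?_, fun A => ?_⟩
  · exact div_le_self hδ.le (by linarith [Nat.cast_nonneg (α := ℝ) i])
  · rw [← Polynomial.eval_finsetSum, Lagrange.sum_basis ht ⟨0, by simp⟩, Polynomial.eval_one]
  · obtain ⟨P, hP, hev⟩ := A.exists_polynomial_det_one_add_smul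
    have hdeg : P.degree < (Finset.range (n + 1)).card := by
      rw [Finset.card_range]
      exact (Polynomial.degree_le_natDegree).trans_lt (by exact_mod_cast Nat.lt_succ_of_le hP)
    have h := congrArg (Polynomial.eval 1) (Lagrange.eq_interpolate ht hdeg)
    rw [hev, one_smul, Lagrange.interpolate_apply, Polynomial.eval_finsetSum] at h
    rw [h]
    exact Finset.sum_congr rfl fun i _ => by
      rw [Polynomial.eval_mul, Polynomial.eval_C, hev, mul_comm]

end Determinants

/-! ### No-retraction argument and zeros of continuous maps. -/

section Retraction

variable {E : Type*} [NormedAddCommGroup E] [InnerProductSpace ℝ E]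

/-- Extending by zero a function that is `K`-Lipschitz on a closed ball and vanishes on the
sphere gives a `K`-Lipschitz function. -/
theorem LipschitzOnWith.indicator_closedBall {h : E → E} {K : ℝ≥0} {r : ℝ}
    (hL : LipschitzOnWith K h (Metric.closedBall 0 r))
    (h0 : ∀ x ∈ Metric.sphere (0 : E) r, h x = 0) :
    LipschitzWith K ((Metric.closedBall (0 : E) r).indicator h) := by
  have key : ∀ x y : E, x ∈ Metric.closedBall (0 : E) r → y ∉ Metric.closedBall (0 : E) r →
      dist (h x) 0 ≤ K * dist x y := by
    intro x y hx hy
    rw [mem_closedBall_zero_iff] at hx hy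
    -- The segment from inside to outside crosses the sphere at `z`, where `h` vanishes.
    obtain ⟨z, hz, hzr⟩ := (convex_segment x y).isPreconnected.intermediate_value
      (left_mem_segment ℝ x y) (right_mem_segment ℝ x y) continuous_norm.continuousOn
      (show r ∈ Icc ‖x‖ ‖y‖ from ⟨hx, (not_le.1 hy).le⟩)
    have hzs : z ∈ Metric.sphere (0 : E) r := by simpa using hzr
    calc dist (h x) 0 = dist (h x) (h z) := by rw [h0 z hzs]
      _ ≤ K * dist x z := hL.dist_le_mul x (by simpa using hx) z
          (Metric.sphere_subset_closedBall hzs)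
      _ ≤ K * dist x y := by
          have := dist_add_dist_of_mem_segment hz
          gcongr
          linarith [dist_nonneg (x := z) (y := y)]
  refine LipschitzWith.of_dist_le_mul fun x y => ?_
  by_cases hx : x ∈ Metric.closedBall (0 : E) r <;> by_cases hy : y ∈ Metric.closedBall (0 : E) r
  · simpa [indicator_of_mem, hx, hy] using hL.dist_le_mul x hx y hy
  · rw [indicator_of_mem hx, indicator_of_notMem hy]
    exact key x y hx hy
  · rw [indicator_of_notMem hx, indicator_of_mem hy, dist_comm, dist_comm x]
    exact key y x hy hx
  · rw [indicator_of_notMem hx, indicator_of_notMem hy, dist_self]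
    positivity

/-- A perturbation of the identity that is small in the Lipschitz sense and vanishes on the sphere
is a bijection of the closed ball. -/
theorem bijOn_closedBall_id_add [CompleteSpace E] {h : E → E} {K : ℝ≥0} {r : ℝ} (hK : K < 1)
    (hL : LipschitzOnWith K h (Metric.closedBall 0 r))
    (h0 : ∀ x ∈ Metric.sphere (0 : E) r, h x = 0) :
    BijOn (fun x => x + h x) (Metric.closedBall 0 r) (Metric.closedBall 0 r) := by
  set B := Metric.closedBall (0 : E) r
  set k := B.indicator h
  have hk : LipschitzWith K k := hL.indicator_closedBall h0
  have hinj : ∀ x y, x + k x = y + k y → x = y := by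
    intro x y hxy
    have h1 := hk.dist_le_mul x y
    have h2 : dist x y = dist (k x) (k y) := by
      rw [dist_eq_norm, dist_eq_norm, ← norm_neg (k x - k y)]
      congr 1
      rw [neg_sub, sub_eq_sub_iff_add_eq_add, hxy, add_comm]
    have h3 : (K : ℝ) < 1 := by exact_mod_cast hK
    by_contra hne
    have := dist_pos.2 hne
    nlinarith
  have hin : ∀ x ∈ B, x + h x = x + k x := fun x hx => by simp [k, hx]
  refine ⟨fun x hx => ?_, fun x hx y hy hxy => ?_, fun y hy => ?_⟩
  -- Outside the ball `k` vanishes, so `x + h x` would have the same image under `id + k` as `x`;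
  -- injectivity then puts it back in the ball.
  · by_contra hout
    have : k (x + h x) = 0 := indicator_of_notMem hout _
    have h2 := hinj x (x + h x) (by rw [this, add_zero, hin x hx])
    refine hout ?_
    change x + h x ∈ B
    rwa [← h2]
  · exact hinj x y (by rw [← hin x hx, ← hin y hy]; exact hxy)
  -- Solving `x + k x = y` is a fixed point problem on the whole space; a solution outside the ball
  -- would equal `y`, which lies inside.
  · have hc : ContractingWith K fun x => y - k x := by
      refine ⟨hK, LipschitzWith.of_dist_le_mul fun a b => ?_⟩
      rw [dist_sub_left]
      exact hk.dist_le_mul a b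
    have hfix : y - k hc.fixedPoint = hc.fixedPoint := hc.fixedPoint_isFixedPt
    set x := hc.fixedPoint
    have hxy : x + k x = y := (sub_eq_iff_eq_add.1 hfix).symm
    have hx : x ∈ B := by
      by_contra hx
      rw [show k x = 0 from indicator_of_notMem hx _, add_zero] at hxy
      exact hx (hxy ▸ hy)
    exact ⟨x, hx, by simpa [k, hx] using hxy⟩

variable [FiniteDimensional ℝ E] [MeasurableSpace E] [BorelSpace E]

/-- The volume of a ball is the integral of the Jacobian determinant of any `C¹` map that is the
identity on the sphere. -/
theorem integral_det_one_add_fderiv_closedBall {h : E → E} {r : ℝ}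
    (hh : ContDiff ℝ 1 h) (h0 : ∀ x ∈ Metric.sphere (0 : E) r, h x = 0) :
    ∫ x in Metric.closedBall (0 : E) r, (1 + fderiv ℝ h x).det =
      volume.real (Metric.closedBall (0 : E) r) := by
  set B := Metric.closedBall (0 : E) r
  have hBc : IsCompact B := isCompact_closedBall 0 r
  have hfc : Continuous (fderiv ℝ h) := hh.continuous_fderiv one_ne_zero
  obtain ⟨C, hC⟩ := hBc.exists_bound_of_continuousOn hfc.continuousOn
  -- The maximum with `1` keeps `K` positive, so that `t ≤ 1 / (2 * K)` makes `t • h` a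
  -- `1/2`-Lipschitz map on the ball.
  set K : ℝ≥0 := ⟨max C 1, by positivity⟩
  have hKpos : 0 < (K : ℝ) := lt_of_lt_of_le one_pos (le_max_right C 1)
  have hK : ∀ x ∈ B, ‖fderiv ℝ h x‖ ≤ K := fun x hx => (hC x hx).trans (le_max_left C 1)
  have hdiff : Differentiable ℝ h := hh.differentiable one_ne_zero
  have hsmall : ∀ t : ℝ, 0 < t → t ≤ 1 / (2 * K) →
      ∫ x in B, (1 + t • fderiv ℝ h x).det = volume.real B := by
    intro t ht htK
    have htK' : t * K ≤ 1 / 2 := by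
      calc t * K ≤ 1 / (2 * K) * K := by gcongr
        _ = 1 / 2 := by field_simp
    have hder : ∀ x, HasFDerivAt (fun x => x + t • h x) (1 + t • fderiv ℝ h x) x := fun x =>
      (hasFDerivAt_id x).add ((hdiff x).hasFDerivAt.const_smul t)
    have hnorm : ∀ x ∈ B, ‖t • fderiv ℝ h x‖ ≤ 1 / 2 := by
      intro x hx
      rw [norm_smul, Real.norm_of_nonneg ht.le]
      exact (mul_le_mul_of_nonneg_left (hK x hx) ht.le).trans htK'
    have hLip : LipschitzOnWith (1 / 2) (fun x => t • h x) B := by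
      refine (convex_closedBall 0 r).lipschitzOnWith_of_nnnorm_hasFDerivWithin_le
        (f' := fun x => t • fderiv ℝ h x)
        (fun x _ => ((hdiff x).hasFDerivAt.const_smul t).hasFDerivWithinAt) fun x hx => ?_
      have := hnorm x hx
      rw [← NNReal.coe_le_coe]
      simpa using this
    have hbij := bijOn_closedBall_id_add (h := fun x => t • h x) (by
      rw [← NNReal.coe_lt_coe]; norm_num) hLip fun x hx => by simp [h0 x hx]
    have hcv := integral_image_eq_integral_abs_det_fderiv_smul volume
      (measurableSet_closedBall (x := (0 : E)) (ε := r))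
      (fun x _ => (hder x).hasFDerivWithinAt) hbij.injOn (fun _ => (1 : ℝ))
    rw [hbij.image_eq] at hcv
    simp only [smul_eq_mul, mul_one, integral_const, measureReal_restrict_apply_univ] at hcv
    rw [hcv]
    refine setIntegral_congr_fun measurableSet_closedBall fun x hx => ?_
    exact (abs_of_pos (ContinuousLinearMap.det_one_add_pos_of_norm_lt_one _
      ((hnorm x hx).trans_lt (by norm_num)))).symm
  -- The weights do not depend on the point `x`, so the interpolation identity can be integrated and
  -- carries the small-`t` result to `t = 1`.
  obtain ⟨s, t, c, ht, hc, hdet⟩ := ContinuousLinearMap.exists_weights_det_one_add (E := E)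
    (δ := 1 / (2 * K)) (by positivity)
  rw [funext fun x => hdet (fderiv ℝ h x), integral_finsetSum]
  · rw [Finset.sum_congr rfl fun i hi => by
        rw [integral_const_mul, hsmall (t i) (ht i hi).1 (ht i hi).2],
      ← Finset.sum_mul, hc, one_mul]
  · intro i _
    have hcont : Continuous fun x => (1 + t i • fderiv ℝ h x).det :=
      ContinuousLinearMap.continuous_det.comp (continuous_const.add (hfc.const_smul (t i)))
    exact Integrable.const_mul (hcont.continuousOn.integrableOn_compact hBc) _

/-- A continuous map that is the identity outside a ball has a zero. -/
theorem exists_eq_zero_of_eq_id_outside_ball {Ψ : E → E} (hΨ : Continuous Ψ) {r : ℝ} (hr : 0 < r)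
    (hid : ∀ x, r < ‖x‖ → Ψ x = x) : ∃ x, Ψ x = 0 := by
  by_contra! hne
  -- An error smaller than `‖Ψ x‖` keeps `g` free of zeros. The radius is doubled because `g` can be
  -- kept equal to `Ψ` only on a closed set near which `Ψ` is already smooth.
  obtain ⟨g, hg, happrox, hgS, -⟩ := hΨ.exists_contDiff_approx_and_eqOn (ε := fun x => ‖Ψ x‖) 1
    hΨ.norm (fun x => norm_pos_iff.2 (hne x)) (S := {x | 2 * r ≤ ‖x‖}) (U := {x | r < ‖x‖})
    (isClosed_le continuous_const continuous_norm)
    ((isOpen_lt continuous_const continuous_norm).mem_nhdsSet.2 fun x hx => by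
      simp only [mem_ofPred_eq] at hx ⊢; linarith)
    (contDiffOn_id.congr fun x hx => hid x hx)
  have hg0 : ∀ x, g x ≠ 0 := by
    intro x hx
    have := happrox x
    rw [hx, dist_zero_left] at this
    exact lt_irrefl _ this
  set Φ : E → E := fun x => (2 * r / ‖g x‖) • g x
  have hΦ : ContDiff ℝ 1 Φ := (contDiff_const.div (hg.norm ℝ hg0) fun x =>
    norm_ne_zero_iff.2 (hg0 x)).smul hg
  have hΦn : ∀ x, ‖Φ x‖ = 2 * r := fun x => by
    have := norm_pos_iff.2 (hg0 x)
    rw [norm_smul, Real.norm_of_nonneg (by positivity)]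
    field_simp
  have hΦs : ∀ x ∈ Metric.sphere (0 : E) (2 * r), Φ x - x = 0 := by
    intro x hx
    have hx' : ‖x‖ = 2 * r := by simpa using hx
    have hgx : g x = x := by
      rw [hgS (show 2 * r ≤ ‖x‖ from hx'.ge), hid x (by linarith)]
    simp only [Φ, hgx, hx']
    rw [div_self (by positivity), one_smul, sub_self]
  have hint := integral_det_one_add_fderiv_closedBall
    (hΦ.sub contDiff_id) hΦs
  have hdet : ∀ x, (1 + fderiv ℝ (Φ - id) x).det = 0 := by
    intro x
    have hd : DifferentiableAt ℝ Φ x := hΦ.differentiable one_ne_zero x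
    have h1 : 1 + fderiv ℝ (Φ - id) x = fderiv ℝ Φ x := by
      rw [fderiv_sub hd differentiableAt_id, fderiv_id]
      exact add_sub_cancel _ _
    rw [h1]
    by_contra hdne
    -- `Φ` has constant norm, so the range of its derivative is orthogonal to `Φ x`; a surjective
    -- derivative would reach `Φ x` itself, which is nonzero.
    have hsurj : Function.Surjective (fderiv ℝ Φ x) := by
      have := LinearMap.isUnit_iff_isUnit_det (fderiv ℝ Φ x).toLinearMap |>.2
        (isUnit_iff_ne_zero.2 hdne)
      exact ((Module.End.isUnit_iff _).1 this).2
    obtain ⟨v, hv⟩ := hsurj (Φ x)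
    have hconst : HasFDerivAt (fun y => inner ℝ (Φ y) (Φ y)) (0 : E →L[ℝ] ℝ) x := by
      have : (fun y => inner ℝ (Φ y) (Φ y)) = fun _ => (2 * r) ^ 2 := by
        funext y; rw [real_inner_self_eq_norm_sq, hΦn]
      rw [this]; exact hasFDerivAt_const _ _
    have h2 := congrArg (fun L : E →L[ℝ] ℝ => L v)
      ((hd.hasFDerivAt.inner ℝ hd.hasFDerivAt).unique hconst)
    simp [fderivInnerCLM_apply, hv, hΦn, hr.ne'] at h2
  have hpos : 0 < volume.real (Metric.closedBall (0 : E) (2 * r)) :=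
    ENNReal.toReal_pos (Metric.measure_closedBall_pos volume _ (by positivity)).ne'
      (isCompact_closedBall _ _).measure_lt_top.ne
  rw [← hint] at hpos
  refine hpos.ne' ?_
  exact integral_eq_zero_of_ae (Filter.Eventually.of_forall fun x => hdet x)

/-- A continuous map `F` of a finite-dimensional space vanishes somewhere if, on some sphere, there
is a field `S` that pairs positively with `F` and nonnegatively with the identity. -/
theorem exists_eq_zero_of_inner_pos_on_sphere {F S : E → E} (hF : Continuous F) {R : ℝ}
    (hR : 0 < R) (hFS : ∀ x, ‖x‖ = R → 0 < inner ℝ (F x) (S x))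
    (hS : ∀ x, ‖x‖ = R → 0 ≤ inner ℝ x (S x)) : ∃ x, F x = 0 := by
  -- `σ` goes from `0` on the ball of radius `R` to `1` beyond `2 * R`, and `π` is the radial
  -- projection onto the former ball. Thus `Ψ` is `F` inside and deforms to the identity outside.
  set σ : E → ℝ := fun x => max 0 (min 1 (‖x‖ / R - 1))
  set π : E → E := fun x => (R / max R ‖x‖) • x
  have hπ : Continuous π := (continuous_const.div (continuous_const.max continuous_norm)
    fun x => (lt_of_lt_of_le hR (le_max_left _ _)).ne').smul continuous_id
  have hσ : Continuous σ := by fun_prop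
  obtain ⟨x, hx⟩ := exists_eq_zero_of_eq_id_outside_ball
    (Ψ := fun x => (1 - σ x) • F (π x) + σ x • x) (r := 2 * R)
    (((continuous_const.sub hσ).smul (hF.comp hπ)).add (hσ.smul continuous_id))
    (by positivity) fun x hx => by
      have h1 : 1 ≤ ‖x‖ / R - 1 := by
        rw [le_sub_iff_add_le, le_div_iff₀ hR]; linarith
      have : σ x = 1 := by simp [σ, h1]
      simp [this]
  refine ⟨π x, ?_⟩
  rcases le_or_gt ‖x‖ R with hle | hgt
  · have h1 : ‖x‖ / R - 1 ≤ 0 := by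
      rw [sub_nonpos, div_le_one hR]; exact hle
    have : σ x = 0 := max_eq_left ((min_le_right _ _).trans h1)
    simpa [this] using hx
  · exfalso
    have hxpos : 0 < ‖x‖ := hR.trans hgt
    have hπx : π x = (R / ‖x‖) • x := by simp only [π, max_eq_right hgt.le]
    have hπn : ‖π x‖ = R := by
      rw [hπx, norm_smul, Real.norm_of_nonneg (by positivity)]; field_simp
    have hxπ : x = (‖x‖ / R) • π x := by
      rw [hπx, smul_smul, div_mul_div_cancel₀ hR.ne', div_self hxpos.ne', one_smul]
    have hσ0 : 0 < σ x := by
      refine lt_max_of_lt_right (lt_min one_pos ?_)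
      rw [sub_pos, one_lt_div hR]; exact hgt
    have hσ1 : σ x ≤ 1 := max_le zero_le_one (min_le_left _ _)
    -- No zero lies outside radius `R`: paired with `S (π x)`, both terms of `Ψ x` are nonnegative
    -- and the first is positive unless `σ x = 1`, in which case `x = 0`.
    have h1 := congrArg (fun y => inner ℝ y (S (π x))) hx
    simp only [inner_add_left, inner_smul_left, inner_zero_left, RCLike.conj_to_real] at h1
    rcases hσ1.eq_or_lt with h | h
    · rw [h] at hx
      simp at hx
      exact hxpos.ne' (by simpa using hx)
    · have h2 : 0 ≤ inner ℝ x (S (π x)) := by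
        calc (0 : ℝ) ≤ ‖x‖ / R * inner ℝ (π x) (S (π x)) := mul_nonneg (by positivity) (hS _ hπn)
          _ = inner ℝ ((‖x‖ / R) • π x) (S (π x)) := (real_inner_smul_left _ _ _).symm
          _ = inner ℝ x (S (π x)) := by rw [← hxπ]
      nlinarith [hFS _ hπn, mul_pos (sub_pos.2 h) (hFS _ hπn), mul_nonneg hσ0.le h2]

end Retraction

/-! ### Zeros under a coercivity condition, and coordinates in `Lp`. -/

section FiniteDimensional

variable {ι : Type*} [Fintype ι]

/-- A continuous map of `ℝ^ι` that pairs positively with `ζ(w)` for `w` large has a zero. -/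
theorem exists_eq_zero_of_sum_mul_pos {F : (ι → ℝ) → ι → ℝ} (hF : Continuous F) {ζ : ℝ → ℝ}
    (hζ : ∀ s, 0 ≤ s * ζ s) {R : ℝ} (hpos : ∀ w, R ≤ ‖w‖ → 0 < ∑ i, F w i * ζ (w i)) :
    ∃ w, F w = 0 := by
  let e := EuclideanSpace.equiv ι ℝ
  -- On the Euclidean sphere of this radius the sup norm is at least `R`; the added `1` makes the
  -- radius positive.
  have hR' : 0 < ‖(e.symm : (ι → ℝ) →L[ℝ] EuclideanSpace ℝ ι)‖ * |R| + 1 := by positivity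
  suffices h : ∃ x, e.symm (F (e x)) = 0 by
    obtain ⟨x, hx⟩ := h
    exact ⟨e x, e.symm.injective (by rw [hx, map_zero])⟩
  refine exists_eq_zero_of_inner_pos_on_sphere (E := EuclideanSpace ℝ ι)
    (F := fun x => e.symm (F (e x))) (S := fun x => e.symm fun i => ζ (x i))
    (e.symm.continuous.comp (hF.comp e.continuous)) hR' (fun x hx => ?_) fun x _ => ?_
  · have hle : R ≤ ‖e x‖ := by
      by_contra! hlt
      have h1 : ‖x‖ ≤ ‖(e.symm : (ι → ℝ) →L[ℝ] EuclideanSpace ℝ ι)‖ * ‖e x‖ := by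
        simpa using (e.symm : (ι → ℝ) →L[ℝ] EuclideanSpace ℝ ι).le_opNorm (e x)
      have h2 := mul_le_mul_of_nonneg_left (hlt.le.trans (le_abs_self R))
        (norm_nonneg (e.symm : (ι → ℝ) →L[ℝ] EuclideanSpace ℝ ι))
      linarith
    simpa [PiLp.inner_apply, e, mul_comm] using hpos (e x) hle
  · rw [PiLp.inner_apply]
    exact Finset.sum_nonneg fun i _ => by simpa [e, mul_comm] using hζ (x i)

theorem exists_forall_mul_rpow_sub_pos {κ p : ℝ} (hκ : 0 < κ) (hp : 1 < p) (C : ℝ) :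
    ∃ s₀ : ℝ, ∀ s, s₀ ≤ s → 0 < κ * s ^ p - C * s := by
  have h := ((tendsto_rpow_atTop (sub_pos.2 hp)).eventually_gt_atTop (C / κ)).and
    (Filter.eventually_gt_atTop 0)
  obtain ⟨s₀, hs₀⟩ := Filter.eventually_atTop.1 h
  refine ⟨s₀, fun s hs => ?_⟩
  obtain ⟨h1, h2⟩ := hs₀ s hs
  have h3 : s ^ p = s ^ (p - 1) * s := by
    rw [← Real.rpow_add_one h2.ne']; ring_nf
  rw [div_lt_iff₀ hκ] at h1
  rw [h3]
  nlinarith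

variable {α : Type*} [MeasurableSpace α] {m : Measure α} {G : Type*} [NormedAddCommGroup G]
  [NormedSpace ℝ G] {q : ℝ≥0∞}

/-- Representatives of `L u` for different `u` are unrelated pointwise; this expansion over fixed
representatives of the basis images gives one that is linear in `u` at every point. -/
theorem coeFn_linearMap_pi [DecidableEq ι] (L : (ι → ℝ) →ₗ[ℝ] Lp G q m) (u : ι → ℝ) :
    L u =ᵐ[m] fun x => ∑ i, u i • L (Pi.single i 1) x := by
  have hu : L u = ∑ i, u i • L (Pi.single i 1) := by
    conv_lhs => rw [show u = ∑ i, u i • Pi.single i (1 : ℝ) by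
      ext j; simp [Finset.sum_apply, Pi.single_apply]]
    simp
  have h2 : ∀ᵐ x ∂m, ∀ i, (u i • L (Pi.single i 1) : Lp G q m) x = u i • L (Pi.single i 1) x :=
    ae_all_iff.2 fun i => Lp.coeFn_smul _ _
  rw [hu]
  filter_upwards [Lp.coeFn_finsetSum Finset.univ fun i => u i • L (Pi.single i 1), h2] with x h1 h2
  rw [h1, Finset.sum_apply]
  exact Finset.sum_congr rfl fun i _ => h2 i

end FiniteDimensional

/-! ### Carathéodory functions and Leray–Lions fluxes. -/

section Caratheodory

/-- Superposition with a Carathéodory function preserves almost everywhere measurability. -/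
theorem AEMeasurable.caratheodory {α Y Z : Type*} [MeasurableSpace α] {m : Measure α}
    [TopologicalSpace Y] [TopologicalSpace.MetrizableSpace Y] [SecondCountableTopology Y]
    [MeasurableSpace Y] [BorelSpace Y] [Nonempty Y]
    [TopologicalSpace Z] [TopologicalSpace.MetrizableSpace Z] [MeasurableSpace Z] [BorelSpace Z]
    [Nonempty Z] {a : α → Y → Z} (hc : ∀ᵐ x ∂m, Continuous (a x))
    (hm : ∀ y, AEMeasurable (fun x => a x y) m) {g : α → Y} (hg : AEMeasurable g m) :
    AEMeasurable (fun x => a x (g x)) m := by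
  classical
  obtain ⟨z₀⟩ := ‹Nonempty Z›
  let D := TopologicalSpace.denseSeq Y
  have hgood : ∀ᵐ x ∂m, Continuous (a x) ∧ ∀ n, a x (D n) = (hm (D n)).mk _ x :=
    hc.and (ae_all_iff.2 fun n => (hm (D n)).ae_eq_mk)
  -- Off the measurable null set `N`, `a x` is continuous and agrees with measurable versions along
  -- a countable dense sequence. Freezing the value on `N` gives `b`, continuous in `y` everywhere
  -- and measurable in `x` by limits along that sequence.
  set N := toMeasurable m {x | ¬(Continuous (a x) ∧ ∀ n, a x (D n) = (hm (D n)).mk _ x)}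
  have hN : MeasurableSet N := measurableSet_toMeasurable _ _
  have hN0 : m N = 0 := by rw [measure_toMeasurable]; exact hgood
  have hNc : ∀ x ∉ N, Continuous (a x) ∧ ∀ n, a x (D n) = (hm (D n)).mk _ x := by
    intro x hx
    by_contra h
    exact hx (subset_toMeasurable _ _ h)
  let b : Y → α → Z := fun y x => if x ∈ N then z₀ else a x y
  have hbc : ∀ x, Continuous fun y => b y x := by
    intro x
    by_cases hx : x ∈ N
    · simpa [b, hx] using continuous_const
    · simpa [b, hx] using (hNc x hx).1
  have hbD : ∀ n, Measurable (b (D n)) := by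
    intro n
    have : b (D n) = N.piecewise (fun _ => z₀) ((hm (D n)).mk _) := by
      funext x
      by_cases hx : x ∈ N
      · simp [b, hx]
      · simp [b, hx, (hNc x hx).2 n]
    rw [this]
    exact measurable_const.piecewise hN (hm (D n)).measurable_mk
  have hbm : ∀ y, Measurable (b y) := by
    intro y
    obtain ⟨s, hs, hlim⟩ := mem_closure_iff_seq_limit.1 (TopologicalSpace.denseRange_denseSeq Y y)
    refine measurable_of_tendsto_metrizable (f := fun k => b (s k)) (fun k => ?_)
      (tendsto_pi_nhds.2 fun x => ((hbc x).tendsto y).comp hlim)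
    obtain ⟨n, hn⟩ := hs k
    rw [← hn]; exact hbD n
  have hb : Measurable (Function.uncurry b) := measurable_uncurry_of_continuous_of_measurable hbc hbm
  refine (hb.comp_aemeasurable (hg.prodMk aemeasurable_id)).congr ?_
  filter_upwards [measure_eq_zero_iff_ae_notMem.1 hN0] with x hx
  simp [b, hx]

variable {α V : Type*} [MeasurableSpace α] {m : Measure α} [NormedAddCommGroup V]
  {A : α → ℝ} {p μ : ℝ}

/-- The growth bound of a Leray--Lions operator lies in the dual Lebesgue space. -/
theorem MeasureTheory.MemLp.add_const_mul_norm_rpow (hp : 1 < p)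
    (hA : MemLp A (ENNReal.ofReal (p / (p - 1))) m) {H : α → V}
    (hH : MemLp H (ENNReal.ofReal p) m) :
    MemLp (fun x => A x + μ * ‖H x‖ ^ (p - 1)) (ENNReal.ofReal (p / (p - 1))) m := by
  have h := hH.norm_rpow_div (ENNReal.ofReal (p - 1))
  rw [← ENNReal.ofReal_div_of_pos (sub_pos.2 hp), ENNReal.toReal_ofReal (sub_pos.2 hp).le] at h
  exact hA.add (h.const_mul μ)

/-- Hölder's inequality; this function dominates the flux pairing, both for integrability and for
dominated convergence. -/
theorem integrable_growth_mul_norm {V' : Type*} [NormedAddCommGroup V'] (hp : 1 < p)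
    (hA : MemLp A (ENNReal.ofReal (p / (p - 1))) m) {H : α → V'} {W : α → V}
    (hH : MemLp H (ENNReal.ofReal p) m) (hW : MemLp W (ENNReal.ofReal p) m) :
    Integrable (fun x => (A x + μ * ‖H x‖ ^ (p - 1)) * ‖W x‖) m := by
  have : (ENNReal.ofReal (p / (p - 1))).HolderConjugate (ENNReal.ofReal p) :=
    (Real.HolderConjugate.conjExponent hp).symm.ennrealOfReal
  exact (hA.add_const_mul_norm_rpow hp hH).integrable_mul hW.norm

variable [InnerProductSpace ℝ V] [FiniteDimensional ℝ V] [MeasurableSpace V] [BorelSpace V]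
  {a : α → ℝ → V → V}

theorem aestronglyMeasurable_inner_flux
    (hc : ∀ᵐ x ∂m, Continuous fun q : ℝ × V => a x q.1 q.2)
    (hm : ∀ s ξ, AEMeasurable (fun x => a x s ξ) m)
    {s : α → ℝ} (hs : AEMeasurable s m) {G W : α → V} (hG : AEStronglyMeasurable G m)
    (hW : AEStronglyMeasurable W m) :
    AEStronglyMeasurable (fun x => inner ℝ (a x (s x) (G x)) (W x)) m := by
  have h := AEMeasurable.caratheodory (a := fun x (q : ℝ × V) => a x q.1 q.2) hc
    (fun q => hm q.1 q.2) (hs.prodMk hG.aemeasurable)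
  exact h.aestronglyMeasurable.inner hW

theorem integrable_inner_flux (hp : 1 < p)
    (hc : ∀ᵐ x ∂m, Continuous fun q : ℝ × V => a x q.1 q.2)
    (hm : ∀ s ξ, AEMeasurable (fun x => a x s ξ) m)
    (hA : MemLp A (ENNReal.ofReal (p / (p - 1))) m)
    (hg : ∀ᵐ x ∂m, ∀ s ξ, ‖a x s ξ‖ ≤ A x + μ * ‖ξ‖ ^ (p - 1))
    {s : α → ℝ} (hs : AEMeasurable s m) {G W : α → V} (hG : MemLp G (ENNReal.ofReal p) m)
    (hW : MemLp W (ENNReal.ofReal p) m) :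
    Integrable (fun x => inner ℝ (a x (s x) (G x)) (W x)) m := by
  refine (integrable_growth_mul_norm (μ := μ) hp hA hG hW).mono'
    (aestronglyMeasurable_inner_flux hc hm hs hG.1 hW.1) ?_
  filter_upwards [hg] with x hx
  exact (norm_inner_le_norm _ _).trans (by gcongr; exact hx _ _)

/-- Continuous dependence of the weak form of a Leray--Lions operator on a parameter. -/
theorem continuous_integral_inner_flux (hp : 1 < p) (hμ : 0 ≤ μ)
    (hc : ∀ᵐ x ∂m, Continuous fun q : ℝ × V => a x q.1 q.2)
    (hm : ∀ s ξ, AEMeasurable (fun x => a x s ξ) m)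
    (hA : MemLp A (ENNReal.ofReal (p / (p - 1))) m)
    (hg : ∀ᵐ x ∂m, ∀ s ξ, ‖a x s ξ‖ ≤ A x + μ * ‖ξ‖ ^ (p - 1))
    {X : Type*} [TopologicalSpace X] [FirstCountableTopology X]
    {s : X → α → ℝ} {G : X → α → V} {W : α → V} (hs : ∀ w, AEMeasurable (s w) m)
    (hG : ∀ w, AEStronglyMeasurable (G w) m) (hW : MemLp W (ENNReal.ofReal p) m)
    (hsc : ∀ x, Continuous fun w => s w x) (hGc : ∀ x, Continuous fun w => G w x)
    (hdom : ∀ w₀, ∃ H : α → ℝ, MemLp H (ENNReal.ofReal p) m ∧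
      ∀ᶠ w in nhds w₀, ∀ x, ‖G w x‖ ≤ ‖H x‖) :
    Continuous fun w => ∫ x, inner ℝ (a x (s w x) (G w x)) (W x) ∂m := by
  refine continuous_iff_continuousAt.2 fun w₀ => ?_
  obtain ⟨H, hH, hb⟩ := hdom w₀
  refine continuousAt_of_dominated (bound := fun x => (A x + μ * ‖H x‖ ^ (p - 1)) * ‖W x‖)
    (Filter.Eventually.of_forall fun w => aestronglyMeasurable_inner_flux hc hm (hs w) (hG w) hW.1)
    ?_ (integrable_growth_mul_norm hp hA hH hW) ?_
  · filter_upwards [hb] with w hw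
    filter_upwards [hg] with x hx
    refine (norm_inner_le_norm _ _).trans (mul_le_mul_of_nonneg_right
      ((hx _ _).trans ?_) (norm_nonneg _))
    have := Real.rpow_le_rpow (norm_nonneg _) (hw x) (sub_pos.2 hp).le
    gcongr
  · filter_upwards [hc] with x hx
    have := hx.comp ((hsc x).prodMk (hGc x))
    exact (this.inner continuous_const).continuousAt

end Caratheodory

/-! ### Solvability of one implicit time step. -/

section TimeStep

theorem continuous_nuFun {ζ β : ℝ → ℝ} {K L : ℝ≥0} (hζ : LipschitzWith K ζ)
    (hβ : LipschitzWith L β) : Continuous (nuFun ζ β) := by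
  refine intervalIntegral.continuous_primitive (fun a b => ?_) 0
  refine (intervalIntegrable_const (c := (K * L : ℝ))).mono_fun'
    ((measurable_deriv ζ).mul (measurable_deriv β)).aestronglyMeasurable
    (Filter.Eventually.of_forall fun q => ?_)
  refine (norm_mul_le _ _).trans ?_
  -- The bound holds at every point, since `deriv` is `0` where the derivative does not exist.
  exact mul_le_mul (norm_deriv_le_of_lipschitz hζ) (norm_deriv_le_of_lipschitz hβ)
    (norm_nonneg _) K.2

theorem integral_norm_rpow_eq_norm_rpow {α V : Type*} [MeasurableSpace α] {m : Measure α}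
    [NormedAddCommGroup V] {p : ℝ} (hp : 0 < p) (g : Lp V (ENNReal.ofReal p) m) :
    ∫ x, ‖g x‖ ^ p ∂m = ‖g‖ ^ p := by
  have h := (Lp.memLp g).eLpNorm_eq_integral_rpow_norm (by simpa using hp) ENNReal.ofReal_ne_top
  rw [ENNReal.toReal_ofReal hp.le] at h
  have h0 : 0 ≤ ∫ x, ‖g x‖ ^ p ∂m := integral_nonneg fun x => by positivity
  rw [Lp.norm_def, h, ENNReal.toReal_ofReal (by positivity), Real.rpow_inv_rpow h0 hp.ne']

theorem mul_nonneg_of_monotone {φ ψ : ℝ → ℝ} (hφ : Monotone φ) (hψ : Monotone ψ) (hφ0 : φ 0 = 0)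
    (hψ0 : ψ 0 = 0) (s : ℝ) : 0 ≤ φ s * ψ s := by
  rcases le_total 0 s with h | h
  · exact mul_nonneg (hφ0 ▸ hφ h) (hψ0 ▸ hψ h)
  · exact mul_nonneg_of_nonpos_of_nonpos (hφ0 ▸ hφ h) (hψ0 ▸ hψ h)

/-- The sup norm of `ζ(w)` is bounded below when `ζ` grows at least linearly. -/
theorem mul_norm_sub_le_norm_comp {ι : Type*} [Fintype ι] {ζ : ℝ → ℝ} {M₀ M₁ : ℝ} (hM₀ : 0 < M₀)
    (hM₁ : 0 ≤ M₁) (hζ : ∀ s, M₀ * |s| - M₁ ≤ |ζ s|) (w : ι → ℝ) :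
    M₀ * ‖w‖ - M₁ ≤ ‖fun i => ζ (w i)‖ := by
  have h : ‖w‖ ≤ (‖fun i => ζ (w i)‖ + M₁) / M₀ := by
    refine (pi_norm_le_iff_of_nonneg (by positivity)).2 fun i => ?_
    rw [le_div_iff₀ hM₀, Real.norm_eq_abs]
    have h1 := norm_le_pi_norm (fun i => ζ (w i)) i
    rw [Real.norm_eq_abs] at h1
    linarith [hζ (w i)]
  rw [le_div_iff₀ hM₀] at h
  linarith

namespace GradientDiscretisation

variable {d : ℕ} {Ω : Set (Rd d)} {T p : ℝ} {ι : Type*} [Fintype ι]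
  (D : GradientDiscretisation Ω T p ι)

/-- The weak form, tested with `v`, of one implicit time step of length `δ` from a state `b` of
`β(u)` to the unknowns `w`. -/
noncomputable def stepForm (ζ β : ℝ → ℝ) (a : Rd d → ℝ → Rd d → Rd d) (δ : ℝ) (b w v : ι → ℝ) :
    ℝ :=
  ∫ x in Ω, (D.recon (δ⁻¹ • ((fun i => β (w i)) - b)) x * D.recon v x
    + inner ℝ (a x (D.recon (fun i => nuFun ζ β (w i)) x) (D.grad (fun i => ζ (w i)) x))
        (D.grad v x))

theorem integrable_recon_mul (hΩ : Bornology.IsBounded Ω) (u v : ι → ℝ) :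
    Integrable (fun x => D.recon u x * D.recon v x) (volume.restrict Ω) := by
  have : IsFiniteMeasure (volume.restrict Ω) := ⟨by
    rw [Measure.restrict_apply_univ]; exact hΩ.measure_lt_top⟩
  have h : MemLp (fun x => D.recon v x * D.recon u x) ∞ (volume.restrict Ω) :=
    (Lp.memLp (D.recon u)).mul (Lp.memLp (D.recon v))
  simpa only [mul_comm] using h.integrable le_top

theorem integral_recon_mul [DecidableEq ι] (hΩ : Bornology.IsBounded Ω) (u v : ι → ℝ) :
    ∫ x in Ω, D.recon u x * D.recon v x =
      ∑ i, u i * ∫ x in Ω, D.recon (Pi.single i 1) x * D.recon v x := by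
  simp_rw [← integral_const_mul]
  rw [← integral_finsetSum _ fun i _ => (D.integrable_recon_mul hΩ _ v).const_mul _]
  refine integral_congr_ae ?_
  filter_upwards [coeFn_linearMap_pi D.recon u] with x hx
  rw [hx, Finset.sum_mul]
  exact Finset.sum_congr rfl fun i _ => by rw [smul_eq_mul, mul_assoc]

/-- The reconstruction is constant on cells that cover `Ω`, so it commutes with nonlinear functions
of the unknowns. This gives the sign of the mass term for `φ = β`, `ψ = ζ`. -/
theorem recon_comp_mul_nonneg (hΩ : MeasurableSet Ω) {φ ψ : ℝ → ℝ} (h : ∀ s, 0 ≤ φ s * ψ s)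
    (w : ι → ℝ) : ∀ᵐ x ∂(volume.restrict Ω),
      0 ≤ D.recon (fun i => φ (w i)) x * D.recon (fun i => ψ (w i)) x := by
  filter_upwards [ae_restrict_mem hΩ, ae_all_iff.2 (D.recon_eq fun i => φ (w i)),
    ae_all_iff.2 (D.recon_eq fun i => ψ (w i))] with x hx h1 h2
  rw [← D.iUnion_cell] at hx
  obtain ⟨i, hi⟩ := mem_iUnion.1 hx
  rw [h1 i hi, h2 i hi]
  exact h _

variable {ζ β : ℝ → ℝ} {a : Rd d → ℝ → Rd d → Rd d} {f : Rd d → ℝ → ℝ}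

theorem integrable_flux_grad (hdata : DataHypotheses d Ω T p ζ β a f) (w v : ι → ℝ) :
    Integrable (fun x => inner ℝ (a x (D.recon (fun i => nuFun ζ β (w i)) x)
      (D.grad (fun i => ζ (w i)) x)) (D.grad v x)) (volume.restrict Ω) := by
  obtain ⟨A, μ, hA, hμ, hg⟩ := hdata.a_growth
  exact integrable_inner_flux hdata.one_lt_p hdata.a_continuous hdata.a_measurable hA hg
    (Lp.aestronglyMeasurable _).aemeasurable (Lp.memLp _) (Lp.memLp _)

theorem integrable_stepForm (hdata : DataHypotheses d Ω T p ζ β a f) (u w v : ι → ℝ) :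
    Integrable (fun x => D.recon u x * D.recon v x +
      inner ℝ (a x (D.recon (fun i => nuFun ζ β (w i)) x)
        (D.grad (fun i => ζ (w i)) x)) (D.grad v x)) (volume.restrict Ω) :=
  (D.integrable_recon_mul hdata.isBounded u v).add (D.integrable_flux_grad hdata w v)

theorem stepForm_eq_add (hdata : DataHypotheses d Ω T p ζ β a f) (δ : ℝ) (b w v : ι → ℝ) :
    D.stepForm ζ β a δ b w v =
      (∫ x in Ω, D.recon (δ⁻¹ • ((fun i => β (w i)) - b)) x * D.recon v x) +
      ∫ x in Ω, inner ℝ (a x (D.recon (fun i => nuFun ζ β (w i)) x)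
        (D.grad (fun i => ζ (w i)) x)) (D.grad v x) :=
  integral_add (D.integrable_recon_mul hdata.isBounded _ _) (D.integrable_flux_grad hdata w v)

/-- The weak form is linear in the test function. -/
theorem stepForm_eq_sum [DecidableEq ι] (hdata : DataHypotheses d Ω T p ζ β a f) (δ : ℝ)
    (b w v : ι → ℝ) :
    D.stepForm ζ β a δ b w v = ∑ i, v i * D.stepForm ζ β a δ b w (Pi.single i 1) := by
  unfold stepForm
  simp_rw [← integral_const_mul]
  rw [← integral_finsetSum _ fun i _ => (D.integrable_stepForm hdata _ w _).const_mul _]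
  refine integral_congr_ae ?_
  filter_upwards [coeFn_linearMap_pi D.recon v, coeFn_linearMap_pi D.grad v] with x h1 h2
  rw [h1, h2, Finset.mul_sum, inner_sum, ← Finset.sum_add_distrib]
  refine Finset.sum_congr rfl fun i _ => ?_
  rw [inner_smul_right, smul_eq_mul]
  ring

/-- The weak form depends continuously on the unknowns. -/
theorem continuous_stepForm (hdata : DataHypotheses d Ω T p ζ β a f) (δ : ℝ) (b v : ι → ℝ) :
    Continuous fun w => D.stepForm ζ β a δ b w v := by
  classical
  obtain ⟨A, μ, hA, hμ, hg⟩ := hdata.a_growth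
  obtain ⟨K, -, hζ⟩ := hdata.zeta_lipschitz
  obtain ⟨L, -, hβ⟩ := hdata.beta_lipschitz
  have hζc := hζ.continuous
  have hβc := hβ.continuous
  have hνc := continuous_nuFun hζ hβ
  rw [funext fun w => D.stepForm_eq_add hdata δ b w v]
  refine Continuous.add ?_ ?_
  · rw [funext fun w : ι → ℝ =>
      D.integral_recon_mul hdata.isBounded (δ⁻¹ • ((fun i => β (w i)) - b)) v]
    refine continuous_finsetSum _ fun i _ => Continuous.mul ?_ continuous_const
    simp only [Pi.smul_apply, Pi.sub_apply, smul_eq_mul]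
    fun_prop
  -- Dominated convergence needs integrands continuous in `w` at each `x`, hence the change of
  -- representatives.
  · have hrep : (fun w : ι → ℝ => ∫ x in Ω, inner ℝ (a x (D.recon (fun i => nuFun ζ β (w i)) x)
        (D.grad (fun i => ζ (w i)) x)) (D.grad v x)) = fun w => ∫ x in Ω, inner ℝ
          (a x (∑ i, nuFun ζ β (w i) • D.recon (Pi.single i 1) x)
            (∑ i, ζ (w i) • D.grad (Pi.single i 1) x)) (D.grad v x) := by
      funext w
      refine integral_congr_ae ?_
      filter_upwards [coeFn_linearMap_pi D.recon fun i => nuFun ζ β (w i),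
        coeFn_linearMap_pi D.grad fun i => ζ (w i)] with x h1 h2
      rw [h1, h2]
    rw [hrep]
    refine continuous_integral_inner_flux hdata.one_lt_p hμ.le hdata.a_continuous
      hdata.a_measurable hA hg (fun w => ?_) (fun w => ?_) (Lp.memLp _) (fun x => ?_)
      (fun x => ?_) fun w₀ => ?_
    · exact ((Lp.aestronglyMeasurable _).congr
        (coeFn_linearMap_pi D.recon fun i => nuFun ζ β (w i))).aemeasurable
    · exact (Lp.aestronglyMeasurable _).congr (coeFn_linearMap_pi D.grad fun i => ζ (w i))
    · fun_prop
    · fun_prop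
    · refine ⟨fun x => (‖fun i => ζ (w₀ i)‖ + 1) * ∑ i, ‖D.grad (Pi.single i 1) x‖,
        (memLp_finsetSum _ fun i _ => (Lp.memLp (D.grad (Pi.single i 1))).norm).const_mul _, ?_⟩
      have hz : Continuous fun w : ι → ℝ => ‖fun i => ζ (w i)‖ := by fun_prop
      filter_upwards [hz.continuousAt.eventually_lt continuousAt_const (lt_add_one _)] with w hw x
      refine le_trans ?_ (le_abs_self _)
      rw [Finset.mul_sum]
      refine (norm_sum_le _ _).trans (Finset.sum_le_sum fun i _ => ?_)
      rw [norm_smul]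
      exact mul_le_mul_of_nonneg_right ((norm_le_pi_norm (fun i => ζ (w i)) i).trans hw.le)
        (norm_nonneg _)

/-- The elliptic part of the weak form is coercive in `ζ(w)`. -/
theorem exists_coercive_flux (hdata : DataHypotheses d Ω T p ζ β a f) :
    ∃ κ : ℝ, 0 < κ ∧ ∀ w : ι → ℝ, κ * ‖fun i => ζ (w i)‖ ^ p ≤
      ∫ x in Ω, inner ℝ (a x (D.recon (fun i => nuFun ζ β (w i)) x)
        (D.grad (fun i => ζ (w i)) x)) (D.grad (fun i => ζ (w i)) x) := by
  have hp0 : 0 < p := one_pos.trans hdata.one_lt_p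
  have : Fact (1 ≤ ENNReal.ofReal p) := ⟨by
    rw [← ENNReal.ofReal_one]; exact ENNReal.ofReal_le_ofReal hdata.one_lt_p.le⟩
  obtain ⟨c, hc, hca⟩ := hdata.a_coercive
  -- An injective linear map on a finite-dimensional space is bounded below: `‖z‖ ≤ K * ‖D.grad z‖`.
  obtain ⟨K, hK, hKg⟩ := D.grad.exists_antilipschitzWith
    (LinearMap.ker_eq_bot'.2 fun u hu => D.grad_norm u (by rw [hu, norm_zero]))
  have hK' : (0 : ℝ) < K := hK
  refine ⟨c * (1 / K) ^ p, by positivity, fun w => ?_⟩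
  set z : ι → ℝ := fun i => ζ (w i)
  have h1 : 1 / K * ‖z‖ ≤ ‖D.grad z‖ := by
    have := hKg.le_mul_dist z 0
    rw [map_zero, dist_zero_right, dist_zero_right] at this
    rwa [one_div, inv_mul_le_iff₀ hK']
  calc c * (1 / K) ^ p * ‖z‖ ^ p = c * (1 / K * ‖z‖) ^ p := by
        rw [Real.mul_rpow (by positivity) (norm_nonneg _), mul_assoc]
    _ ≤ c * ‖D.grad z‖ ^ p := by gcongr
    _ = ∫ x in Ω, c * ‖D.grad z x‖ ^ p := by
        rw [integral_const_mul, integral_norm_rpow_eq_norm_rpow hp0]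
    _ ≤ _ := by
        refine integral_mono_ae ?_ (D.integrable_flux_grad hdata w z) ?_
        · have := (Lp.memLp (D.grad z)).integrable_norm_rpow (by simpa using hp0)
            ENNReal.ofReal_ne_top
          rw [ENNReal.toReal_ofReal hp0.le] at this
          exact this.const_mul c
        · filter_upwards [hca] with x hx
          exact hx _ _

/-- One implicit time step is solvable. -/
theorem exists_stepForm_eq [DecidableEq ι] (hdata : DataHypotheses d Ω T p ζ β a f) {δ : ℝ}
    (hδ : 0 < δ) (b l : ι → ℝ) : ∃ w : ι → ℝ, ∀ v, D.stepForm ζ β a δ b w v = ∑ i, v i * l i := by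
  have hid : ∀ s, 0 ≤ s * ζ s :=
    mul_nonneg_of_monotone monotone_id hdata.zeta_mono rfl hdata.zeta_zero
  obtain ⟨M₀, M₁, hM₀, hM₁, hM⟩ := hdata.zeta_coercive
  obtain ⟨κ, hκ, hcoer⟩ := D.exists_coercive_flux hdata
  -- `k` collects the previous state and the source: everything that enters linearly when testing
  -- with `ζ(w)`.
  let k : ι → ℝ := fun i => δ⁻¹ * (∫ x in Ω, D.recon (Pi.single i 1) x * D.recon b x) + l i
  obtain ⟨s₀, hs₀⟩ := exists_forall_mul_rpow_sub_pos hκ hdata.one_lt_p (∑ i, |k i|)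
  have hlow : ∀ w : ι → ℝ, κ * ‖fun i => ζ (w i)‖ ^ p - (∑ i, |k i|) * ‖fun i => ζ (w i)‖ ≤
      ∑ i, (D.stepForm ζ β a δ b w (Pi.single i 1) - l i) * ζ (w i) := by
    intro w
    set z : ι → ℝ := fun i => ζ (w i)
    have hsum : ∑ i, (D.stepForm ζ β a δ b w (Pi.single i 1) - l i) * ζ (w i) =
        D.stepForm ζ β a δ b w z - ∑ i, z i * l i := by
      rw [D.stepForm_eq_sum hdata, ← Finset.sum_sub_distrib]
      exact Finset.sum_congr rfl fun i _ => by simp only [z]; ring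
    have hmass : ∫ x in Ω, D.recon (δ⁻¹ • ((fun i => β (w i)) - b)) x * D.recon z x =
        δ⁻¹ * (∫ x in Ω, D.recon (fun i => β (w i)) x * D.recon z x) -
        δ⁻¹ * ∫ x in Ω, D.recon b x * D.recon z x := by
      rw [D.integral_recon_mul hdata.isBounded (δ⁻¹ • _) z,
        D.integral_recon_mul hdata.isBounded (fun i => β (w i)) z,
        D.integral_recon_mul hdata.isBounded b z, Finset.mul_sum, Finset.mul_sum, ← Finset.sum_sub_distrib]
      exact Finset.sum_congr rfl fun i _ => by
        simp only [Pi.smul_apply, Pi.sub_apply, smul_eq_mul]; ring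
    have hpos : 0 ≤ ∫ x in Ω, D.recon (fun i => β (w i)) x * D.recon z x :=
      integral_nonneg_of_ae (D.recon_comp_mul_nonneg hdata.isOpen.measurableSet
        (mul_nonneg_of_monotone hdata.beta_mono hdata.zeta_mono hdata.beta_zero
          hdata.zeta_zero) w)
    have hb : ∫ x in Ω, D.recon b x * D.recon z x =
        ∑ i, z i * ∫ x in Ω, D.recon (Pi.single i 1) x * D.recon b x := by
      rw [← D.integral_recon_mul hdata.isBounded]
      simp_rw [mul_comm]
    have hk : δ⁻¹ * (∫ x in Ω, D.recon b x * D.recon z x) + ∑ i, z i * l i = ∑ i, z i * k i := by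
      rw [hb, Finset.mul_sum, ← Finset.sum_add_distrib]
      exact Finset.sum_congr rfl fun i _ => by simp only [k]; ring
    have hkle : ∑ i, z i * k i ≤ (∑ i, |k i|) * ‖z‖ := by
      rw [Finset.sum_mul]
      refine Finset.sum_le_sum fun i _ => ?_
      calc z i * k i ≤ |z i * k i| := le_abs_self _
        _ = |k i| * |z i| := by rw [abs_mul, mul_comm]
        _ ≤ |k i| * ‖z‖ := by gcongr; exact norm_le_pi_norm z i
    rw [hsum, D.stepForm_eq_add hdata, hmass]
    have := mul_nonneg (inv_nonneg.2 hδ.le) hpos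
    linarith [hcoer w]
  obtain ⟨w, hw⟩ := exists_eq_zero_of_sum_mul_pos
    (F := fun w i => D.stepForm ζ β a δ b w (Pi.single i 1) - l i) (ζ := ζ)
    -- By coercivity of `ζ`, `‖w‖ ≥ R` forces `‖ζ(w)‖ ≥ s₀`, where the power `p` beats the linear
    -- term.
    (R := (s₀ + M₁) / M₀)
    (continuous_pi fun i => (D.continuous_stepForm hdata δ b _).sub continuous_const) hid
    fun w hw => by
      rw [div_le_iff₀ hM₀] at hw
      exact (hs₀ _ (by linarith [mul_norm_sub_le_norm_comp hM₀ hM₁.le hM w])).trans_le (hlow w)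
  refine ⟨w, fun v => ?_⟩
  rw [D.stepForm_eq_sum hdata]
  exact Finset.sum_congr rfl fun i _ => by rw [sub_eq_zero.1 (congrFun hw i)]

end GradientDiscretisation

end TimeStep

/-! ### Decomposition over time steps and the recursion. -/

namespace GradientDiscretisation

variable {d : ℕ} {Ω : Set (Rd d)} {T p : ℝ} {ι : Type*} [Fintype ι]
  (D : GradientDiscretisation Ω T p ι)

theorem time_castSucc_lt_succ (n : Fin D.N) : D.time n.castSucc < D.time n.succ :=
  D.time_strictMono Fin.castSucc_lt_succ

theorem Ioc_time_subset (n : Fin D.N) :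
    Ioc (D.time n.castSucc) (D.time n.succ) ⊆ Ioc 0 T := by
  refine Ioc_subset_Ioc ?_ ?_
  · exact D.time_zero.ge.trans (D.time_strictMono.monotone (Fin.zero_le _))
  · exact (D.time_strictMono.monotone (Fin.le_last _)).trans D.time_last.le

theorem stepFun_eq (w : Fin D.N → ι → ℝ) {n : Fin D.N} {t : ℝ}
    (ht : t ∈ Ioc (D.time n.castSucc) (D.time n.succ)) : D.stepFun w t = w n := by
  unfold stepFun
  rw [Finset.sum_eq_single n, indicator_of_mem ht]
  · intro k _ hk
    refine indicator_of_notMem (fun hkt => ?_) _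
    rcases lt_or_gt_of_ne hk with h | h
    · have : D.time k.succ ≤ D.time n.castSucc :=
        D.time_strictMono.monotone (Fin.succ_le_castSucc_iff.2 h)
      linarith [hkt.2, ht.1]
    · have : D.time n.succ ≤ D.time k.castSucc :=
        D.time_strictMono.monotone (Fin.succ_le_castSucc_iff.2 h)
      linarith [hkt.1, ht.2]
  · simp

/-- An integral over `(0,T)` is the sum of the integrals over the time steps. -/
theorem integral_eq_sum_steps {g : ℝ → ℝ} {G : Fin D.N → ℝ → ℝ}
    (hG : ∀ n, IntegrableOn (G n) (Ioc (D.time n.castSucc) (D.time n.succ)))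
    (hg : ∀ n, ∀ t ∈ Ioc (D.time n.castSucc) (D.time n.succ), g t = G n t) :
    ∫ t in (0 : ℝ)..T, g t = ∑ n, ∫ t in D.time n.castSucc..D.time n.succ, G n t := by
  -- Times are extended to natural indices to sum over adjacent intervals; the value beyond `D.N` is
  -- never used.
  let τ : ℕ → ℝ := fun k => if h : k < D.N + 1 then D.time ⟨k, h⟩ else T
  have h1 : ∀ n : Fin D.N, τ n = D.time n.castSucc := fun n => by
    simp only [τ]
    rw [dif_pos (n.2.trans (Nat.lt_succ_self _))]
    rfl
  have h2 : ∀ n : Fin D.N, τ (n + 1) = D.time n.succ := fun n => by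
    simp only [τ]
    rw [dif_pos (Nat.succ_lt_succ n.2)]
    rfl
  have h0 : τ 0 = 0 := by
    simp only [τ]
    rw [dif_pos (Nat.succ_pos _)]
    exact D.time_zero
  have hT : τ D.N = T := by
    simp only [τ]
    rw [dif_pos (Nat.lt_succ_self _)]
    exact D.time_last
  have hint : ∀ k < D.N, IntervalIntegrable g volume (τ k) (τ (k + 1)) := by
    intro k hk
    have e1 := h1 ⟨k, hk⟩
    have e2 := h2 ⟨k, hk⟩
    simp only at e1 e2
    rw [e1, e2, intervalIntegrable_iff_integrableOn_Ioc_of_le (D.time_castSucc_lt_succ _).le]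
    exact (hG ⟨k, hk⟩).congr_fun (fun t ht => (hg _ t ht).symm) measurableSet_Ioc
  have hsum := intervalIntegral.sum_integral_adjacent_intervals hint
  rw [h0, hT] at hsum
  rw [← hsum, ← Fin.sum_univ_eq_sum_range fun k => ∫ t in τ k..τ (k + 1), g t]
  refine Finset.sum_congr rfl fun n _ => ?_
  rw [h1, h2, intervalIntegral.integral_of_le (D.time_castSucc_lt_succ n).le,
    intervalIntegral.integral_of_le (D.time_castSucc_lt_succ n).le]
  exact setIntegral_congr_fun measurableSet_Ioc (hg n)

variable {ζ β : ℝ → ℝ} {a : Rd d → ℝ → Rd d → Rd d} {f : Rd d → ℝ → ℝ}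

/-- The conjugate exponent is at least `1` and the space-time cylinder has finite measure, so `f` is
integrable, while the reconstruction is essentially bounded. -/
theorem integrable_source_mul_recon (hdata : DataHypotheses d Ω T p ζ β a f) (v : ι → ℝ) :
    Integrable (fun z : Rd d × ℝ => f z.1 z.2 * D.recon v z.1)
      ((volume.restrict Ω).prod (volume.restrict (Ioc 0 T))) := by
  have : IsFiniteMeasure (volume.restrict Ω) := ⟨by
    rw [Measure.restrict_apply_univ]; exact hdata.isBounded.measure_lt_top⟩
  have hf := hdata.f_memLp
  rw [Measure.volume_eq_prod, ← Measure.prod_restrict, restrict_Ioo_eq_restrict_Ioc] at hf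
  have hp' : 1 ≤ ENNReal.ofReal (p / (p - 1)) := by
    rw [← ENNReal.ofReal_one]
    refine ENNReal.ofReal_le_ofReal ((one_le_div (sub_pos.2 hdata.one_lt_p)).2 (by linarith))
  have h1 : MemLp (fun z : Rd d × ℝ => f z.1 z.2) 1
      ((volume.restrict Ω).prod (volume.restrict (Ioc 0 T))) := hf.mono_exponent hp'
  have h2 := (Lp.memLp (D.recon v)).comp_fst (volume.restrict (Ioc 0 T))
  exact memLp_one_iff_integrable.1 (h2.mul h1)

theorem integrable_integral_source (hdata : DataHypotheses d Ω T p ζ β a f) (v : ι → ℝ)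
    (n : Fin D.N) : IntegrableOn (fun t => ∫ x in Ω, f x t * D.recon v x)
      (Ioc (D.time n.castSucc) (D.time n.succ)) :=
  IntegrableOn.mono_set (D.integrable_source_mul_recon hdata v).integral_prod_right
    (D.Ioc_time_subset n)

/-- The source term of a time step is linear in the test function. -/
theorem integral_source_eq_sum [DecidableEq ι] (hdata : DataHypotheses d Ω T p ζ β a f)
    (v : ι → ℝ) (n : Fin D.N) :
    ∫ t in D.time n.castSucc..D.time n.succ, ∫ x in Ω, f x t * D.recon v x =
      ∑ i, v i * ∫ t in D.time n.castSucc..D.time n.succ,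
        ∫ x in Ω, f x t * D.recon (Pi.single i 1) x := by
  have hle := (D.time_castSucc_lt_succ n).le
  simp_rw [intervalIntegral.integral_of_le hle,
    ← integral_const_mul (μ := volume.restrict (Ioc _ _))]
  rw [← integral_finsetSum _ fun i _ => (D.integrable_integral_source hdata _ n).const_mul _]
  refine integral_congr_ae ?_
  -- By Fubini almost every time slice is integrable, which allows the finite sum to leave the inner
  -- integral.
  have hae : ∀ᵐ t ∂(volume.restrict (Ioc (D.time n.castSucc) (D.time n.succ))),
      ∀ i, Integrable (fun x => f x t * D.recon (Pi.single i 1) x) (volume.restrict Ω) :=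
    ae_all_iff.2 fun i => ae_restrict_of_ae_restrict_of_subset (D.Ioc_time_subset n)
      (D.integrable_source_mul_recon hdata (Pi.single i 1)).prod_left_ae
  filter_upwards [hae] with t ht
  simp_rw [← integral_const_mul]
  rw [← integral_finsetSum _ fun i _ => (ht i).const_mul _]
  refine integral_congr_ae ?_
  filter_upwards [coeFn_linearMap_pi D.recon v] with x hx
  rw [hx, Finset.mul_sum]
  exact Finset.sum_congr rfl fun i _ => by rw [smul_eq_mul]; ring

end GradientDiscretisation

theorem corollary4p2 {d : ℕ} {Ω : Set (Rd d)} {T p : ℝ} {ζ β : ℝ → ℝ}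
    {a : Rd d → ℝ → Rd d → Rd d} {f : Rd d → ℝ → ℝ}
    (hdata : DataHypotheses d Ω T p ζ β a f) (uini : Lp ℝ 2 (volume.restrict Ω))
    {ι : Type*} [Fintype ι] (D : GradientDiscretisation Ω T p ι) :
    ∃ u : Fin (D.N + 1) → ι → ℝ, D.IsSchemeSolution ζ β a f uini u := by
  classical
  have hstep : ∀ (n : Fin D.N) (b : ι → ℝ), ∃ w : ι → ℝ, ∀ v,
      (D.time n.succ - D.time n.castSucc) *
        D.stepForm ζ β a (D.time n.succ - D.time n.castSucc) (fun i => β (b i)) w v =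
      ∫ t in D.time n.castSucc..D.time n.succ, ∫ x in Ω, f x t * D.recon v x := by
    intro n b
    have hδ := sub_pos.2 (D.time_castSucc_lt_succ n)
    obtain ⟨w, hw⟩ := D.exists_stepForm_eq hdata hδ (fun i => β (b i))
      -- The load is the time average of the source: in the scheme the step form is constant on the
      -- interval and gets multiplied by its length.
      fun i => (D.time n.succ - D.time n.castSucc)⁻¹ *
        ∫ t in D.time n.castSucc..D.time n.succ, ∫ x in Ω, f x t * D.recon (Pi.single i 1) x
    refine ⟨w, fun v => ?_⟩
    rw [hw, D.integral_source_eq_sum hdata, Finset.mul_sum]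
    exact Finset.sum_congr rfl fun i _ => by field_simp
  choose w hw using hstep
  -- A step is solvable from any previous state, so the recursion needs no bound propagated in time.
  let u : Fin (D.N + 1) → ι → ℝ := Fin.induction (D.interp uini) w
  have hu : ∀ n : Fin D.N, u n.succ = w n (u n.castSucc) := fun n => Fin.induction_succ ..
  refine ⟨u, rfl, fun v => ?_⟩
  rw [D.integral_eq_sum_steps (G := fun n _ => D.stepForm ζ β a
      (D.time n.succ - D.time n.castSucc) (fun i => β (u n.castSucc i)) (u n.succ) (v n))
      (fun n => by simp) (fun n t ht => by simp only [D.stepFun_eq _ ht]; rfl),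
    D.integral_eq_sum_steps (G := fun n t => ∫ x in Ω, f x t * D.recon (v n) x)
      (fun n => D.integrable_integral_source hdata _ n)
      (fun n t ht => by simp only [D.stepFun_eq _ ht])]
  refine Finset.sum_congr rfl fun n _ => ?_
  rw [intervalIntegral.integral_const, smul_eq_mul, hu]
  exact hw n _ _
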